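/- **Conventions.** Fix an o-minimal structure over $\mathbb R$ expanding the real field (for instance, the semialgebraic sets); all sets and maps below are required to be definable in it. The empty set counts as connected. A *coordinate cone* in $\mathbb R^n$ is a set $\{x : x_j\,\sigma_j\,c_j \text{ for } j\in J\}$ with $J\subset\{1,\dots,n\}$, $\sigma_j\in\{<,=,>\}$, $c_j\in\mathbb R$. An open bounded set $X\subset\mathbb R^n$ is *semi-monotone* if $X\cap C$ is connected for every coordinate cone $C$. A bounded upper semicontinuous function $f$ on a non-empty semi-monotone set $X$ is *submonotone* if $\{x\in X : f(x)<b\}$ is semi-monotone for every $b\in\mathbb R$, and $f$ is *supermonotone* if $-f$ is submonotone. A function $f$ on $X$ is *independent of* $x_j$ if $f(x)=f(y)$ whenever $x,y\in X$ differ only in the $j$-th coordinate. A function on $X$ is *monotone* if it is both submonotone and supermonotone and, for each $j$, it is either strictly increasing in $x_j$, or strictly decreasing in $x_j$, or independent of $x_j$ on $X$. Let $X\subset\mathbb R^n$ be non-empty and semi-monotone and let $f=(f_1,\dots,f_k):X\to\mathbb R^k$ be bounded and continuous, with graph $F\subset\mathbb R^{n+k}$ in the coordinates $x_1,\dots,x_n,y_1,\dots,y_k$.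 A set $H$ of $n$ of these $n+k$ coordinates is a *basis set* of $f$ if the projection of $F$ to the coordinates in $H$ is injective. The map $f$ is *monotone* in the following cases, by induction on $n$. If $n=0$, always. If $n=1$, when each $f_i$ is a monotone function. If $n\ge 2$, when for all $i,j$ such that $f_i$ is not independent of $x_j$: 1. for every $b\in\mathbb R$ the set $F\cap\{y_i=b\}$, considered in the space of all coordinates except $y_i$, is, when non-empty, the graph of a monotone map $f_{i,j,b}$ from a semi-monotone subset of $\operatorname{span}\{x_1,\dots,x_{j-1},x_{j+1},\dots,x_n\}$ to $\operatorname{span}\{y_1,\dots,y_{i-1},x_j,y_{i+1},\dots,y_k\}$; and 2. the system of basis sets of $f_{i,j,b}$ is the same for all $b$ for which this set is non-empty. (In particular, for $k=0$ the graphs of monotone maps are the non-empty semi-monotone sets.) **Theorem.** Let $d,n\ge 0$, let $\mathbf a_1,\dots,\mathbf a_n\in\mathbb N^d$ (where $0\in\mathbb N$), and let $$C=\{(\mathbf t^{\mathbf a_1},\dots,\mathbf t^{\mathbf a_n}) : \mathbf t\in(0,1)^d\}\subset\mathbb R^n,\qquad \mathbf t^{\mathbf a_i}=t_1^{a_{i,1}}\cdots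 t_d^{a_{i,d}},$$ be the corresponding open toric cube. Then $C$ is the graph of a monotone map: the coordinates of $\mathbb R^n$ can be split into $m$ coordinates and the $k=n-m$ remaining ones so that, in these coordinates, $C$ is the graph of a monotone map $f:X\to\mathbb R^k$ on a non-empty semi-monotone set $X\subset\mathbb R^m$. -/

import Mathlib

/-- An o-minimal structure over `ℝ`, expanding the real field: for each `n` a Boolean algebra of
"definable" subsets of `ℝⁿ`, containing the real algebraic sets, closed under products and under
projections, such that the definable subsets of `ℝ` are finite unions of points and intervals
(the order-connected subsets of `ℝ` are exactly the intervals, points and the empty set included;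
that every such finite union is definable follows from the other axioms). -/
structure OMinimalStructure where
  /-- the definable subsets of `ℝⁿ` -/
  Definable : ∀ {n : ℕ}, Set (Fin n → ℝ) → Prop
  compl : ∀ {n : ℕ} {A : Set (Fin n → ℝ)}, Definable A → Definable Aᶜ
  union : ∀ {n : ℕ} {A B : Set (Fin n → ℝ)}, Definable A → Definable B → Definable (A ∪ B)
  algebraic : ∀ {n : ℕ} (p : MvPolynomial (Fin n) ℝ),
    Definable {x : Fin n → ℝ | MvPolynomial.eval x p = 0}
  prod : ∀ {m n : ℕ} {A : Set (Fin m → ℝ)} {B : Set (Fin n → ℝ)}, Definable A → Definable B →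
    Definable {z : Fin (m + n) → ℝ |
      (fun i => z (Fin.castAdd n i)) ∈ A ∧ (fun i => z (Fin.natAdd m i)) ∈ B}
  proj : ∀ {n : ℕ} {A : Set (Fin (n + 1) → ℝ)}, Definable A →
    Definable ((fun (x : Fin (n + 1) → ℝ) (i : Fin n) => x i.castSucc) '' A)
  o_minimal : ∀ {A : Set (Fin 1 → ℝ)}, Definable A →
    ∃ T : Set (Set ℝ), T.Finite ∧ (∀ I ∈ T, I.OrdConnected) ∧
      {x : ℝ | (fun _ => x) ∈ A} = ⋃₀ T

/-- A coordinate cone in `ℝⁿ`: an intersection of sets `{x_j σ_j c_j}` over a set `J` of distinct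
coordinates, each `σ_j` being one of `<`, `=`, `>`. -/
def IsCoordinateCone {n : ℕ} (C : Set (Fin n → ℝ)) : Prop :=
  ∃ (J : Finset (Fin n)) (σ : Fin n → Ordering) (c : Fin n → ℝ),
    C = {x | ∀ j ∈ J, (σ j).Compares (x j) (c j)}

/-- Semi-monotone sets: definable open bounded sets (possibly empty) whose intersection with each
coordinate cone is connected, where the empty set counts as connected. -/
structure IsSemiMonotone (𝒮 : OMinimalStructure) {n : ℕ} (X : Set (Fin n → ℝ)) : Prop where
  definable : 𝒮.Definable X
  isOpen : IsOpen X
  isBounded : Bornology.IsBounded X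
  connected : ∀ C : Set (Fin n → ℝ), IsCoordinateCone C → IsPreconnected (X ∩ C)

/-- The graph `{(x, y) | x ∈ X, y = f x}` in `ℝⁿ⁺ᵏ` of the map `f : X → ℝᵏ`. Here and below, the
values of `f` outside of `X` play no role. -/
def mapGraph {n k : ℕ} (X : Set (Fin n → ℝ)) (f : (Fin n → ℝ) → (Fin k → ℝ)) :
    Set (Fin (n + k) → ℝ) :=
  {z | ∃ x ∈ X, z = Fin.append x (f x)}

/-- A submonotone function on the non-empty semi-monotone set `X`. -/
structure IsSubmonotone (𝒮 : OMinimalStructure) {n : ℕ} (X : Set (Fin n → ℝ))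
    (f : (Fin n → ℝ) → ℝ) : Prop where
  nonempty : X.Nonempty
  domain : IsSemiMonotone 𝒮 X
  definable : 𝒮.Definable (mapGraph X (fun x (_ : Fin 1) => f x))
  bounded : Bornology.IsBounded (f '' X)
  usc : UpperSemicontinuousOn f X
  sublevel : ∀ b : ℝ, IsSemiMonotone 𝒮 {x ∈ X | f x < b}

/-- A function `f` is supermonotone if `-f` is submonotone. -/
def IsSupermonotone (𝒮 : OMinimalStructure) {n : ℕ} (X : Set (Fin n → ℝ))
    (f : (Fin n → ℝ) → ℝ) : Prop :=
  IsSubmonotone 𝒮 X (fun x => -f x)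

/-- `f` is strictly increasing in the coordinate `x_j` on `X`. -/
def StrictIncrIn {n : ℕ} (X : Set (Fin n → ℝ)) (f : (Fin n → ℝ) → ℝ) (j : Fin n) : Prop :=
  ∀ x ∈ X, ∀ y ∈ X, (∀ l, l ≠ j → x l = y l) → x j < y j → f x < f y

/-- `f` is strictly decreasing in the coordinate `x_j` on `X`. -/
def StrictDecrIn {n : ℕ} (X : Set (Fin n → ℝ)) (f : (Fin n → ℝ) → ℝ) (j : Fin n) : Prop :=
  ∀ x ∈ X, ∀ y ∈ X, (∀ l, l ≠ j → x l = y l) → x j < y j → f y < f x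

/-- `f` is independent of the coordinate `x_j` on `X`. -/
def IndependentOf {n : ℕ} (X : Set (Fin n → ℝ)) (f : (Fin n → ℝ) → ℝ) (j : Fin n) : Prop :=
  ∀ x ∈ X, ∀ y ∈ X, (∀ l, l ≠ j → x l = y l) → f x = f y

/-- Monotone functions on a non-empty semi-monotone set `X`. -/
structure IsMonotoneFun (𝒮 : OMinimalStructure) {n : ℕ} (X : Set (Fin n → ℝ))
    (f : (Fin n → ℝ) → ℝ) : Prop where
  sub : IsSubmonotone 𝒮 X f
  super : IsSupermonotone 𝒮 X f
  coord : ∀ j : Fin n, StrictIncrIn X f j ∨ StrictDecrIn X f j ∨ IndependentOf X f j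

/-- The system of basis sets of `f : X → ℝᵏ`, `X ⊆ ℝⁿ`. The coordinates `x_1, …, x_n` are labelled
by `Sum.inl`, the coordinates `y_1, …, y_k` by `Sum.inr`. A set `H` of `n` of them is a basis if
the map from `X` to `ℝⁿ` formed by the coordinates in `H` of `(x, f x)` is injective. -/
def basisSets {n k : ℕ} (X : Set (Fin n → ℝ)) (f : (Fin n → ℝ) → (Fin k → ℝ)) :
    Set (Finset (Fin n ⊕ Fin k)) :=
  {H | H.card = n ∧ Set.InjOn (fun x (h : H) => Sum.elim x (f x) h.1) X}

/-- A definable, bounded and continuous map on a non-empty semi-monotone set. -/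
structure IsBoundedContinuousMap (𝒮 : OMinimalStructure) {n k : ℕ} (X : Set (Fin n → ℝ))
    (f : (Fin n → ℝ) → (Fin k → ℝ)) : Prop where
  nonempty : X.Nonempty
  domain : IsSemiMonotone 𝒮 X
  definable : 𝒮.Definable (mapGraph X f)
  bounded : Bornology.IsBounded (f '' X)
  continuousOn : ContinuousOn f X

/-- For the graph `F` of `f : X → ℝᵏ`, `X ⊆ ℝⁿ⁺¹`: the set `F ∩ {y_i = b}`, considered in
the space of all coordinates but `y_i`, is the graph of `g : X' → ℝᵏ`, where `X'` lies in the space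
of all `x`-coordinates but `x_j`, and where the `i`-th coordinate of the target of `g` is `x_j`. -/
def IsSliceGraph {n k : ℕ} (X : Set (Fin (n + 1) → ℝ)) (f : (Fin (n + 1) → ℝ) → (Fin k → ℝ))
    (i : Fin k) (j : Fin (n + 1)) (b : ℝ)
    (X' : Set (Fin n → ℝ)) (g : (Fin n → ℝ) → (Fin k → ℝ)) : Prop :=
  ∀ (x : Fin (n + 1) → ℝ) (y : Fin k → ℝ), y i = b →
    (Fin.append x y ∈ mapGraph X f ↔
      Fin.append (j.removeNth x) (Function.update y i (x j)) ∈ mapGraph X' g)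

/-- Monotone maps `f : X → ℝᵏ` on non-empty semi-monotone sets `X ⊆ ℝⁿ`, by induction on `n`.
For `n = 0` (where `X` is the point `ℝ⁰`) every map is monotone, and for `k = 0` every
non-empty semi-monotone set is the domain, and the graph, of a monotone map.
For `n ≥ 2`: whenever `f_i` is not independent of `x_j`, all non-empty slices `F ∩ {y_i = b}` of
the graph are graphs of monotone maps `f_{i,j,b}`, with one system `B` of basis sets common to
all `b`. -/
def IsMonotoneMap (𝒮 : OMinimalStructure) {k : ℕ} :
    (n : ℕ) → Set (Fin n → ℝ) → ((Fin n → ℝ) → (Fin k → ℝ)) → Prop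
  | 0, X, f => IsBoundedContinuousMap 𝒮 X f
  | 1, X, f => IsBoundedContinuousMap 𝒮 X f ∧ ∀ i : Fin k, IsMonotoneFun 𝒮 X (fun x => f x i)
  | n + 2, X, f => IsBoundedContinuousMap 𝒮 X f ∧
      ∀ (i : Fin k) (j : Fin (n + 2)), ¬ IndependentOf X (fun x => f x i) j →
        ∃ B : Set (Finset (Fin (n + 1) ⊕ Fin k)),
          ∀ b : ℝ, (∃ x ∈ X, f x i = b) →
            ∃ (X' : Set (Fin (n + 1) → ℝ)) (g : (Fin (n + 1) → ℝ) → (Fin k → ℝ)),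
              IsSliceGraph X f i j b X' g ∧ IsMonotoneMap 𝒮 (n + 1) X' g ∧ basisSets X' g = B

/-- `C ⊆ ℝⁿ` is the graph of a monotone map: after splitting the `n` coordinates of the ambient
space into `m` coordinates of the domain and `k` coordinates of the target (by the bijection `e`),
`C` is the graph of a monotone map `f : X → ℝᵏ` with `X ⊆ ℝᵐ`. -/
def IsGraphOfMonotoneMap (𝒮 : OMinimalStructure) {n : ℕ} (C : Set (Fin n → ℝ)) : Prop :=
  ∃ (m k : ℕ) (e : Fin (m + k) ≃ Fin n) (X : Set (Fin m → ℝ))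
    (f : (Fin m → ℝ) → (Fin k → ℝ)),
    IsMonotoneMap 𝒮 m X f ∧ C = {z | z ∘ e ∈ mapGraph X f}

/-- The open toric cube of `a_1, …, a_n ∈ ℕᵈ`: the image of `(0,1)ᵈ` under the monomial map
`t ↦ (t^{a_1}, …, t^{a_n})`. -/
def openToricCube {d n : ℕ} (a : Fin n → Fin d → ℕ) : Set (Fin n → ℝ) :=
  (fun (t : Fin d → ℝ) (i : Fin n) => ∏ l, t l ^ a i l) '' {t | ∀ l, t l ∈ Set.Ioo (0 : ℝ) 1}

/-! In logarithmic coordinates the cube is the image of the open negative orthant under the linear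
map with matrix `a`. Choose a basis among the rows of `a` for their span. The basis coordinates map
the orthant onto a set `U`, which is convex, and open because independent rows give a surjective
linear map; the other coordinates are linear functions of them, with some matrix `Q`. So the cube is
the graph of a map that is affine in logarithmic coordinates (`IsLogAffine`).

Such maps are monotone (`IsLogAffine.isMonotoneMap`). The exponential is increasing in each
coordinate, so coordinate cones and sublevel sets of the components pull back to convex sets, which
gives all the connectedness required. A slice `y_i = b` fixes one affine equation; solving it for
the logarithm of `x_j` gives a log-affine map in one variable fewer (`IsLogAffine.exists_slice`).
Its matrix `pivot Q i j` is independent of `b`, only the constant term changes, and basis sets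
depend only on the matrix (`IsLogAffine.basisSets_eq`). Induction on the dimension of the domain
finishes the proof.

The exponential need not be definable in `𝒮`, so definability is carried separately: the cube is a
projection of a semialgebraic set, and definability of graphs passes to slices. -/

/-! ### Definable sets from the axioms -/

namespace OMinimalStructure

variable (𝒮 : OMinimalStructure) {n m : ℕ}

lemma inter {A B : Set (Fin n → ℝ)} (hA : 𝒮.Definable A) (hB : 𝒮.Definable B) :
    𝒮.Definable (A ∩ B) := by
  have h := 𝒮.compl (𝒮.union (𝒮.compl hA) (𝒮.compl hB))
  rwa [Set.compl_union, compl_compl, compl_compl] at h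

lemma definable_univ : 𝒮.Definable (Set.univ : Set (Fin n → ℝ)) := by
  simpa using 𝒮.algebraic (0 : MvPolynomial (Fin n) ℝ)

lemma definable_eq (p q : MvPolynomial (Fin n) ℝ) :
    𝒮.Definable {x | MvPolynomial.eval x p = MvPolynomial.eval x q} := by
  simpa [sub_eq_zero] using 𝒮.algebraic (p - q)

lemma definable_finset_forall {ι : Type*} (s : Finset ι) {A : ι → Set (Fin n → ℝ)}
    (h : ∀ i ∈ s, 𝒮.Definable (A i)) : 𝒮.Definable {x | ∀ i ∈ s, x ∈ A i} := by
  classical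
  induction s using Finset.induction_on with
  | empty => simpa using 𝒮.definable_univ
  | insert i s hi ih =>
    have := 𝒮.inter (h i (Finset.mem_insert_self i s))
      (ih fun j hj => h j (Finset.mem_insert_of_mem hj))
    convert this using 1
    ext x
    simp

lemma definable_forall {ι : Type*} [Fintype ι] {A : ι → Set (Fin n → ℝ)}
    (h : ∀ i, 𝒮.Definable (A i)) : 𝒮.Definable {x | ∀ i, x ∈ A i} := by
  simpa using 𝒮.definable_finset_forall Finset.univ (A := A) fun i _ => h i

lemma definable_image_castAdd {A : Set (Fin (n + m) → ℝ)} (hA : 𝒮.Definable A) :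
    𝒮.Definable ((fun (x : Fin (n + m) → ℝ) (i : Fin n) => x (Fin.castAdd m i)) '' A) := by
  induction m with
  | zero => simpa using hA
  | succ m ih =>
    have h := ih (𝒮.proj (n := n + m) hA)
    rwa [Set.image_image] at h

/-- Definable sets are closed under existential quantification over several variables. -/
lemma definable_exists {A : Set (Fin (n + m) → ℝ)} (hA : 𝒮.Definable A) :
    𝒮.Definable {x : Fin n → ℝ | ∃ y : Fin m → ℝ, Fin.append x y ∈ A} := by
  convert 𝒮.definable_image_castAdd hA using 1
  ext x
  constructor
  · rintro ⟨y, hy⟩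
    exact ⟨_, hy, by ext i; simp⟩
  · rintro ⟨z, hz, rfl⟩
    exact ⟨fun i => z (Fin.natAdd n i), by simpa [Fin.append_castAdd_natAdd] using hz⟩

/-- Definable sets are closed under preimages by maps which select coordinates. -/
lemma definable_reindex (σ : Fin m → Fin n) {A : Set (Fin m → ℝ)} (hA : 𝒮.Definable A) :
    𝒮.Definable {z : Fin n → ℝ | z ∘ σ ∈ A} := by
  -- The preimage is the projection of the set of pairs `(z, y)` with `y ∈ A` and `y i = z (σ i)`.
  have h := 𝒮.definable_exists (𝒮.inter (𝒮.prod (m := n) 𝒮.definable_univ hA)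
    (𝒮.definable_forall fun i : Fin m => 𝒮.definable_eq
      (MvPolynomial.X (Fin.natAdd n i)) (MvPolynomial.X (Fin.castAdd m (σ i)))))
  convert h using 1
  ext z
  simp only [Set.mem_ofPred_eq, Set.mem_inter_iff, Set.mem_univ, true_and, MvPolynomial.eval_X,
    Fin.append_left, Fin.append_right]
  constructor
  · intro hz
    exact ⟨z ∘ σ, hz, fun i => rfl⟩
  · rintro ⟨y, hy, h⟩
    rwa [show z ∘ σ = y from funext fun i => (h i).symm]

/-- The order comes from the algebraic axiom: `p > 0` exactly when `y² p = 1` is solvable in `y`. -/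
lemma definable_pos (p : MvPolynomial (Fin n) ℝ) :
    𝒮.Definable {x | 0 < MvPolynomial.eval x p} := by
  have h := 𝒮.definable_exists (m := 1) (𝒮.definable_eq
    (MvPolynomial.X (Fin.natAdd n 0) ^ 2 * MvPolynomial.rename (Fin.castAdd 1) p) 1)
  convert h using 1
  ext x
  have hx : ∀ y : Fin 1 → ℝ, Fin.append x y ∘ Fin.castAdd 1 = x := fun y => by ext i; simp
  simp only [Set.mem_ofPred_eq, map_mul, map_pow, MvPolynomial.eval_X, MvPolynomial.eval_rename,
    map_one, hx, Fin.append_right]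
  constructor
  · intro hp
    refine ⟨fun _ => (√(MvPolynomial.eval x p))⁻¹, ?_⟩
    rw [inv_pow, Real.sq_sqrt hp.le, inv_mul_cancel₀ hp.ne']
  · rintro ⟨y, hy⟩
    by_contra hp
    nlinarith [sq_nonneg (y 0), mul_nonneg (sq_nonneg (y 0)) (neg_nonneg.2 (not_lt.1 hp))]

lemma definable_lt (p q : MvPolynomial (Fin n) ℝ) :
    𝒮.Definable {x | MvPolynomial.eval x p < MvPolynomial.eval x q} := by
  simpa [sub_pos] using 𝒮.definable_pos (q - p)

/-- Open toric cubes are definable in every o-minimal structure. -/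
lemma definable_openToricCube {d : ℕ} (a : Fin n → Fin d → ℕ) :
    𝒮.Definable (openToricCube a) := by
  have h := 𝒮.definable_exists (n := n) (m := d) (𝒮.inter (𝒮.inter
    (𝒮.definable_forall fun l : Fin d => 𝒮.definable_lt 0 (MvPolynomial.X (Fin.natAdd n l)))
    (𝒮.definable_forall fun l : Fin d => 𝒮.definable_lt (MvPolynomial.X (Fin.natAdd n l)) 1))
    (𝒮.definable_forall fun i : Fin n => 𝒮.definable_eq
      (∏ l, MvPolynomial.X (Fin.natAdd n l) ^ a i l) (MvPolynomial.X (Fin.castAdd d i))))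
  convert h using 1
  ext z
  simp [openToricCube, funext_iff, forall_and]

end OMinimalStructure

/-! ### Graphs of maps and the definability of what is derived from them -/

section Graph

variable (𝒮 : OMinimalStructure) {n k : ℕ} {X : Set (Fin n → ℝ)}
  {f : (Fin n → ℝ) → (Fin k → ℝ)}

lemma append_mem_mapGraph {x : Fin n → ℝ} {y : Fin k → ℝ} :
    Fin.append x y ∈ mapGraph X f ↔ x ∈ X ∧ y = f x := by
  constructor
  · rintro ⟨x', hx', h⟩
    have h1 : x = x' := funext fun i => by simpa using congrFun h (Fin.castAdd k i)
    have h2 : y = f x' := funext fun i => by simpa using congrFun h (Fin.natAdd n i)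
    exact ⟨h1 ▸ hx', h1 ▸ h2⟩
  · rintro ⟨hx, rfl⟩
    exact ⟨x, hx, rfl⟩

lemma mem_mapGraph {z : Fin (n + k) → ℝ} :
    z ∈ mapGraph X f ↔ z ∘ Fin.castAdd k ∈ X ∧ z ∘ Fin.natAdd n = f (z ∘ Fin.castAdd k) := by
  rw [← append_mem_mapGraph]
  exact iff_of_eq (congrArg (· ∈ mapGraph X f) (Fin.append_castAdd_natAdd (f := z)).symm)


lemma definable_domain (hf : 𝒮.Definable (mapGraph X f)) : 𝒮.Definable X := by
  convert 𝒮.definable_exists hf using 1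
  ext x
  simp [append_mem_mapGraph]

/-- Used with `p = X i` and `p = -X i`, for the submonotone and the supermonotone condition on
`f_i`. -/
lemma definable_sublevel_comp (hf : 𝒮.Definable (mapGraph X f)) (p : MvPolynomial (Fin k) ℝ)
    (b : ℝ) : 𝒮.Definable {x ∈ X | MvPolynomial.eval (f x) p < b} := by
  have h := 𝒮.definable_exists (𝒮.inter hf (𝒮.definable_lt
    (MvPolynomial.rename (Fin.natAdd n) p) (MvPolynomial.C b)))
  convert h using 1
  ext x
  have hx : ∀ y : Fin k → ℝ, Fin.append x y ∘ Fin.natAdd n = y := fun y => by ext i; simp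
  simp [append_mem_mapGraph, MvPolynomial.eval_rename, hx, and_assoc]

lemma definable_mapGraph_comp (hf : 𝒮.Definable (mapGraph X f)) (p : MvPolynomial (Fin k) ℝ) :
    𝒮.Definable (mapGraph X fun x (_ : Fin 1) => MvPolynomial.eval (f x) p) := by
  have h := 𝒮.definable_exists (n := n + 1) (m := k) (𝒮.inter
    (𝒮.definable_reindex
      (Fin.append (Fin.castAdd k ∘ Fin.castAdd 1) (Fin.natAdd (n + 1))) hf)
    (𝒮.definable_eq (MvPolynomial.X (Fin.castAdd k (Fin.natAdd n 0)))
      (MvPolynomial.rename (Fin.natAdd (n + 1)) p)))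
  convert h using 1
  ext z
  have h1 : ∀ y : Fin k → ℝ, Fin.append z y ∘ Fin.natAdd (n + 1) = y :=
    fun y => by ext i; simp
  have h2 : ∀ y : Fin k → ℝ, Fin.append z y ∘
      Fin.append (Fin.castAdd k ∘ Fin.castAdd 1) (Fin.natAdd (n + 1)) =
      Fin.append (z ∘ Fin.castAdd 1) y := by
    intro y
    ext i
    refine Fin.addCases (fun i => ?_) (fun i => ?_) i <;> simp
  rw [mem_mapGraph]
  simp only [Set.mem_ofPred_eq, Set.mem_inter_iff, h1, h2, append_mem_mapGraph,
    MvPolynomial.eval_X, MvPolynomial.eval_rename, Fin.append_left]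
  constructor
  · rintro ⟨hz, h⟩
    exact ⟨_, ⟨hz, rfl⟩, congrFun h 0⟩
  · rintro ⟨y, ⟨hz, rfl⟩, h⟩
    exact ⟨hz, funext fun i => by rw [Subsingleton.elim i 0]; exact h⟩

/-- If `g` is the slice `y_i = b` of `f`, then the graph of `g` is definable. -/
lemma IsSliceGraph.definable {X : Set (Fin (n + 1) → ℝ)} {f : (Fin (n + 1) → ℝ) → (Fin k → ℝ)}
    {i : Fin k} {j : Fin (n + 1)} {b : ℝ} {X' : Set (Fin n → ℝ)}
    {g : (Fin n → ℝ) → (Fin k → ℝ)} (hg : IsSliceGraph X f i j b X' g)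
    (hf : 𝒮.Definable (mapGraph X f)) : 𝒮.Definable (mapGraph X' g) := by
  -- The slice keeps `x_j` in slot `i` of its target. The reindexing moves it back among the source
  -- coordinates, and the additional variable, constrained to equal `b`, takes the place of `y_i`.
  have h := 𝒮.definable_exists (n := n + k) (m := 1) (𝒮.inter
    (𝒮.definable_reindex
      (Fin.append
        (j.insertNth (Fin.castAdd 1 (Fin.natAdd n i)) (Fin.castAdd 1 ∘ Fin.castAdd k) :
          Fin (n + 1) → Fin (n + k + 1))
        (Function.update (Fin.castAdd 1 ∘ Fin.natAdd n) i (Fin.natAdd (n + k) 0))) hf)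
    (𝒮.definable_eq (MvPolynomial.X (Fin.natAdd (n + k) 0)) (MvPolynomial.C b)))
  convert h using 1
  ext z
  have key : ∀ s : Fin 1 → ℝ, Fin.append z s ∘ (Fin.append
        (j.insertNth (Fin.castAdd 1 (Fin.natAdd n i)) (Fin.castAdd 1 ∘ Fin.castAdd k) :
          Fin (n + 1) → Fin (n + k + 1))
        (Function.update (Fin.castAdd 1 ∘ Fin.natAdd n) i (Fin.natAdd (n + k) 0))) =
      Fin.append (j.insertNth (z (Fin.natAdd n i)) (z ∘ Fin.castAdd k) : Fin (n + 1) → ℝ)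
        (Function.update (z ∘ Fin.natAdd n) i (s 0)) := by
    intro s
    ext l
    refine Fin.addCases (fun l => ?_) (fun l => ?_) l
    · refine Fin.succAboveCases j ?_ (fun l => ?_) l <;> simp
    · by_cases hl : l = i
      · subst hl; simp
      · simp [hl]
  have hz := hg (j.insertNth (z (Fin.natAdd n i)) (z ∘ Fin.castAdd k))
    (Function.update (z ∘ Fin.natAdd n) i b) (by simp)
  have hz' : Fin.append (z ∘ Fin.castAdd k) (z ∘ Fin.natAdd n) = z :=
    Fin.append_castAdd_natAdd (f := z)
  have hu : Function.update (z ∘ Fin.natAdd n) i (z (Fin.natAdd n i)) = z ∘ Fin.natAdd n :=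
    Function.update_eq_self i _
  rw [Fin.removeNth_insertNth, Function.update_idem, Fin.insertNth_apply_same, hu, hz'] at hz
  rw [← hz]
  simp only [Set.mem_ofPred_eq, Set.mem_inter_iff, key, MvPolynomial.eval_X, MvPolynomial.eval_C,
    Fin.append_right]
  constructor
  · exact fun h => ⟨fun _ => b, h, rfl⟩
  · rintro ⟨s, hs, rfl⟩
    exact hs

end Graph

/-! ### Logarithmic coordinates -/

open Matrix

/-- The coordinatewise exponential. -/
noncomputable def expMap {ι : Type*} (u : ι → ℝ) : ι → ℝ := fun i => Real.exp (u i)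

section ExpMap

variable {ι : Type*}

lemma expMap_injective : Function.Injective (expMap : (ι → ℝ) → ι → ℝ) := fun _ _ h =>
  funext fun i => Real.exp_injective (congrFun h i)

lemma continuous_expMap : Continuous (expMap : (ι → ℝ) → ι → ℝ) :=
  continuous_pi fun i => Real.continuous_exp.comp (continuous_apply i)

lemma isOpen_expMap_image [Finite ι] {U : Set (ι → ℝ)} (hU : IsOpen U) :
    IsOpen (expMap '' U) := by
  have h : expMap '' U = {x | ∀ i, 0 < x i} ∩ (fun x i => Real.log (x i)) ⁻¹' U := by
    ext x
    constructor
    · rintro ⟨u, hu, rfl⟩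
      exact ⟨fun i => Real.exp_pos _, by simpa [expMap] using hu⟩
    · rintro ⟨hx, hu⟩
      exact ⟨_, hu, funext fun i => Real.exp_log (hx i)⟩
  rw [h]
  refine ContinuousOn.isOpen_inter_preimage ?_ ?_ hU
  · exact continuousOn_pi.2 fun i => (continuous_apply i).continuousOn.log fun x hx => (hx i).ne'
  · simp only [Set.ofPred_forall]
    exact isOpen_iInter_of_finite fun i => isOpen_lt continuous_const (continuous_apply i)

lemma isPreconnected_expMap_image {U : Set (ι → ℝ)} (hU : Convex ℝ U) :
    IsPreconnected (expMap '' U) :=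
  hU.isPreconnected.image _ continuous_expMap.continuousOn

/-- By monotonicity of `exp` the set is order-connected. The shift `d` serves the constant terms of
affine maps. -/
lemma convex_compares_exp (σ : Ordering) (c d : ℝ) :
    Convex ℝ {s : ℝ | σ.Compares (Real.exp (s + d)) c} := by
  refine Set.OrdConnected.convex ⟨fun x hx y hy z hz => ?_⟩
  have h1 : Real.exp (x + d) ≤ Real.exp (z + d) := Real.exp_le_exp.2 (by linarith [hz.1])
  have h2 : Real.exp (z + d) ≤ Real.exp (y + d) := Real.exp_le_exp.2 (by linarith [hz.2])
  cases σ
  · exact lt_of_le_of_lt h2 hy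
  · exact le_antisymm (h2.trans (le_of_eq hy)) ((le_of_eq hx.symm).trans h1)
  · exact lt_of_lt_of_le hx h1

lemma IsCoordinateCone.convex_expMap_preimage {n : ℕ} {C : Set (Fin n → ℝ)}
    (hC : IsCoordinateCone C) : Convex ℝ (expMap ⁻¹' C) := by
  obtain ⟨J, σ, c, rfl⟩ := hC
  have h : expMap ⁻¹' {x : Fin n → ℝ | ∀ j ∈ J, (σ j).Compares (x j) (c j)} =
      ⋂ j ∈ J, LinearMap.proj (R := ℝ) (φ := fun _ : Fin n => ℝ) j ⁻¹'
        {s : ℝ | (σ j).Compares (Real.exp (s + 0)) (c j)} := by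
    ext u
    simp [expMap]
  rw [h]
  exact convex_iInter₂ fun j _ => (convex_compares_exp _ _ _).linear_preimage _

/-- A coordinate cone meets the set in the exponential image of a convex set. Definability is
assumed for the image, since `U` itself need not be definable in `𝒮`. -/
lemma isSemiMonotone_expMap_image (𝒮 : OMinimalStructure) {n : ℕ} {U : Set (Fin n → ℝ)}
    (ho : IsOpen U) (hc : Convex ℝ U) (hd : 𝒮.Definable (expMap '' U))
    (hb : Bornology.IsBounded (expMap '' U)) : IsSemiMonotone 𝒮 (expMap '' U) where
  definable := hd
  isOpen := isOpen_expMap_image ho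
  isBounded := hb
  connected C hC := by
    rw [← Set.image_inter_preimage]
    exact isPreconnected_expMap_image (hc.inter hC.convex_expMap_preimage)

end ExpMap

/-! ### Log-affine maps: components and basis sets -/

/-- A map `f : X → ℝᵏ` which is affine in logarithmic coordinates, with matrix of exponents `Q`,
on a set `X` which in these coordinates is the non-empty open convex set `U`. -/
structure IsLogAffine {n k : ℕ} (U : Set (Fin n → ℝ)) (Q : Matrix (Fin k) (Fin n) ℝ)
    (c : Fin k → ℝ) (X : Set (Fin n → ℝ)) (f : (Fin n → ℝ) → (Fin k → ℝ)) : Prop where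
  isOpen : IsOpen U
  convex : Convex ℝ U
  nonempty : U.Nonempty
  domain : X = expMap '' U
  apply : ∀ u ∈ U, f (expMap u) = expMap (Q *ᵥ u + c)

namespace IsLogAffine

variable {n k : ℕ} {U : Set (Fin n → ℝ)} {Q : Matrix (Fin k) (Fin n) ℝ}
  {c : Fin k → ℝ} {X : Set (Fin n → ℝ)} {f : (Fin n → ℝ) → (Fin k → ℝ)}

lemma continuousOn (h : IsLogAffine U Q c X f) : ContinuousOn f X := by
  have hpos : ∀ x ∈ X, ∀ i, 0 < x i := by
    rw [h.domain]
    rintro _ ⟨u, -, rfl⟩ i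
    exact Real.exp_pos _
  have hlog : ContinuousOn (fun (x : Fin n → ℝ) i => Real.log (x i)) X :=
    continuousOn_pi.2 fun i => (continuous_apply i).continuousOn.log fun x hx => (hpos x hx i).ne'
  have hg : Continuous fun u : Fin n → ℝ => expMap (Q *ᵥ u + c) :=
    continuous_expMap.comp
      ((Continuous.matrix_mulVec continuous_const continuous_id).add continuous_const)
  refine (hg.comp_continuousOn hlog).congr ?_
  rw [h.domain]
  rintro _ ⟨u, hu, rfl⟩
  simp [h.apply u hu, expMap]

/-- The set of points where a component of a log-affine map compares to a constant in a given way
is convex in logarithmic coordinates. -/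
lemma sep_compares_eq (h : IsLogAffine U Q c X f) (σ : Ordering) (i : Fin k) (b : ℝ) :
    {x ∈ X | σ.Compares (f x i) b} =
      expMap '' (U ∩ {u | σ.Compares (expMap (Q *ᵥ u + c) i) b}) := by
  rw [h.domain]
  ext x
  constructor
  · rintro ⟨⟨u, hu, rfl⟩, hx⟩
    rw [h.apply u hu] at hx
    exact ⟨u, ⟨hu, hx⟩, rfl⟩
  · rintro ⟨u, ⟨hu, hx⟩, rfl⟩
    refine ⟨⟨u, hu, rfl⟩, ?_⟩
    rw [h.apply u hu]
    exact hx

lemma convex_sep (Q : Matrix (Fin k) (Fin n) ℝ) (c : Fin k → ℝ) (σ : Ordering) (i : Fin k)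
    (b : ℝ) : Convex ℝ {u : Fin n → ℝ | σ.Compares (expMap (Q *ᵥ u + c) i) b} :=
  (convex_compares_exp σ b (c i)).linear_preimage
    (LinearMap.proj (R := ℝ) (φ := fun _ : Fin k => ℝ) i ∘ₗ Q.mulVecLin)

lemma continuous_expMap_affine (Q : Matrix (Fin k) (Fin n) ℝ) (c : Fin k → ℝ) (i : Fin k) :
    Continuous fun u : Fin n → ℝ => expMap (Q *ᵥ u + c) i :=
  (continuous_apply i).comp (continuous_expMap.comp
    ((Continuous.matrix_mulVec continuous_const continuous_id).add continuous_const))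

variable {𝒮 : OMinimalStructure}

lemma isSemiMonotone (h : IsLogAffine U Q c X f) (hd : 𝒮.Definable (mapGraph X f))
    (hX : Bornology.IsBounded X) : IsSemiMonotone 𝒮 X := by
  have hdX := definable_domain 𝒮 hd
  have hdom := h.domain
  subst hdom
  exact isSemiMonotone_expMap_image 𝒮 h.isOpen h.convex hdX hX

lemma isBoundedContinuousMap (h : IsLogAffine U Q c X f) (hd : 𝒮.Definable (mapGraph X f))
    (hX : Bornology.IsBounded X) (hf : Bornology.IsBounded (f '' X)) :
    IsBoundedContinuousMap 𝒮 X f where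
  nonempty := h.domain ▸ h.nonempty.image _
  domain := h.isSemiMonotone hd hX
  definable := hd
  bounded := hf
  continuousOn := h.continuousOn

lemma isSubmonotone_apply (h : IsLogAffine U Q c X f) (hd : 𝒮.Definable (mapGraph X f))
    (hX : Bornology.IsBounded X) (hf : Bornology.IsBounded (f '' X)) (i : Fin k) :
    IsSubmonotone 𝒮 X (fun x => f x i) where
  nonempty := h.domain ▸ h.nonempty.image _
  domain := h.isSemiMonotone hd hX
  definable := by simpa using definable_mapGraph_comp 𝒮 hd (MvPolynomial.X i)
  bounded := by
    have := (LipschitzWith.eval (α := fun _ : Fin k => ℝ) i).isBounded_image hf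
    rwa [Set.image_image] at this
  usc := ((continuous_apply i).comp_continuousOn h.continuousOn).upperSemicontinuousOn
  sublevel b := by
    have hdb : 𝒮.Definable {x ∈ X | f x i < b} := by
      simpa using definable_sublevel_comp 𝒮 hd (MvPolynomial.X i) b
    have hbb := hX.subset (Set.sep_subset X fun x => f x i < b)
    have e : {x ∈ X | f x i < b} = _ := h.sep_compares_eq .lt i b
    rw [e] at hdb hbb ⊢
    exact isSemiMonotone_expMap_image 𝒮
      (h.isOpen.inter (isOpen_lt (continuous_expMap_affine Q c i) continuous_const))
      (h.convex.inter (convex_sep Q c .lt i b)) hdb hbb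

lemma isSupermonotone_apply (h : IsLogAffine U Q c X f) (hd : 𝒮.Definable (mapGraph X f))
    (hX : Bornology.IsBounded X) (hf : Bornology.IsBounded (f '' X)) (i : Fin k) :
    IsSupermonotone 𝒮 X (fun x => f x i) where
  nonempty := h.domain ▸ h.nonempty.image _
  domain := h.isSemiMonotone hd hX
  definable := by simpa using definable_mapGraph_comp 𝒮 hd (-MvPolynomial.X i)
  bounded := by
    have := (LipschitzWith.eval (α := fun _ : Fin k => ℝ) i).neg.isBounded_image hf
    rwa [Set.image_image] at this
  usc := ((continuous_apply i).comp_continuousOn h.continuousOn).neg.upperSemicontinuousOn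
  sublevel b := by
    have hdb : 𝒮.Definable {x ∈ X | -f x i < b} := by
      simpa using definable_sublevel_comp 𝒮 hd (-MvPolynomial.X i) b
    have hbb := hX.subset (Set.sep_subset X fun x => -f x i < b)
    have e : {x ∈ X | -f x i < b} =
        expMap '' (U ∩ {u | Ordering.gt.Compares (expMap (Q *ᵥ u + c) i) (-b)}) := by
      rw [← h.sep_compares_eq .gt i (-b)]
      ext x
      exact and_congr_right fun _ => neg_lt
    rw [e] at hdb hbb ⊢
    exact isSemiMonotone_expMap_image 𝒮
      (h.isOpen.inter (isOpen_lt continuous_const (continuous_expMap_affine Q c i)))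
      (h.convex.inter (convex_sep Q c .gt i (-b))) hdb hbb

/-- Only the `j`-th summand changes, so the sign of `Q i j` decides how the `i`-th component varies
with `x_j`. -/
lemma mulVec_sub_of_eq_off (Q : Matrix (Fin k) (Fin n) ℝ) {u v : Fin n → ℝ} {j : Fin n}
    (huv : ∀ l, l ≠ j → u l = v l) (i : Fin k) :
    (Q *ᵥ v) i - (Q *ᵥ u) i = Q i j * (v j - u j) := by
  rw [← Pi.sub_apply, ← Matrix.mulVec_sub, Matrix.mulVec, dotProduct,
    Finset.sum_eq_single j (fun l _ hl => by simp [huv l hl]) (by simp), Pi.sub_apply]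

/-- The contrapositive supplies the non-zero pivot needed for slicing. -/
lemma independentOf (h : IsLogAffine U Q c X f) {i : Fin k} {j : Fin n} (hq : Q i j = 0) :
    IndependentOf X (fun x => f x i) j := by
  intro x hx y hy hxy
  rw [h.domain] at hx hy
  obtain ⟨u, hu, rfl⟩ := hx
  obtain ⟨v, hv, rfl⟩ := hy
  have := mulVec_sub_of_eq_off Q (fun l hl => Real.exp_injective (hxy l hl)) i
  rw [hq, zero_mul, sub_eq_zero] at this
  simp [h.apply u hu, h.apply v hv, expMap, this]

lemma strictIncrIn (h : IsLogAffine U Q c X f) {i : Fin k} {j : Fin n} (hq : 0 < Q i j) :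
    StrictIncrIn X (fun x => f x i) j := by
  intro x hx y hy hxy hj
  rw [h.domain] at hx hy
  obtain ⟨u, hu, rfl⟩ := hx
  obtain ⟨v, hv, rfl⟩ := hy
  have := mulVec_sub_of_eq_off Q (fun l hl => Real.exp_injective (hxy l hl)) i
  have := mul_pos hq (sub_pos.2 (Real.exp_lt_exp.1 hj))
  simp only [h.apply u hu, h.apply v hv, expMap, Pi.add_apply, Real.exp_lt_exp]
  linarith

lemma strictDecrIn (h : IsLogAffine U Q c X f) {i : Fin k} {j : Fin n} (hq : Q i j < 0) :
    StrictDecrIn X (fun x => f x i) j := by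
  intro x hx y hy hxy hj
  rw [h.domain] at hx hy
  obtain ⟨u, hu, rfl⟩ := hx
  obtain ⟨v, hv, rfl⟩ := hy
  have := mulVec_sub_of_eq_off Q (fun l hl => Real.exp_injective (hxy l hl)) i
  have := mul_neg_of_neg_of_pos hq (sub_pos.2 (Real.exp_lt_exp.1 hj))
  simp only [h.apply u hu, h.apply v hv, expMap, Pi.add_apply, Real.exp_lt_exp]
  linarith

lemma isMonotoneFun_apply (h : IsLogAffine U Q c X f) (hd : 𝒮.Definable (mapGraph X f))
    (hX : Bornology.IsBounded X) (hf : Bornology.IsBounded (f '' X)) (i : Fin k) :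
    IsMonotoneFun 𝒮 X (fun x => f x i) where
  sub := h.isSubmonotone_apply hd hX hf i
  super := h.isSupermonotone_apply hd hX hf i
  coord j := by
    rcases lt_trichotomy (Q i j) 0 with hq | hq | hq
    · exact .inr (.inl (h.strictDecrIn hq))
    · exact .inr (.inr (h.independentOf hq))
    · exact .inl (h.strictIncrIn hq)

/-- The basis sets of a log-affine map depend only on its matrix of exponents. -/
lemma basisSets_eq (h : IsLogAffine U Q c X f) :
    basisSets X f = {H : Finset (Fin n ⊕ Fin k) | H.card = n ∧ Function.Injective
      fun (v : Fin n → ℝ) (l : ↥H) => Sum.elim v (Q *ᵥ v) l.1} := by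
  have coord : ∀ u ∈ U, ∀ v ∈ U, ∀ l : Fin n ⊕ Fin k,
      Sum.elim (expMap u) (f (expMap u)) l = Sum.elim (expMap v) (f (expMap v)) l ↔
        Sum.elim u (Q *ᵥ u) l = Sum.elim v (Q *ᵥ v) l := by
    intro u hu v hv l
    rw [h.apply u hu, h.apply v hv]
    cases l <;> simp [expMap]
  ext H
  refine and_congr_right fun _ => ⟨fun hi v w hvw => ?_, fun hi x hx y hy hxy => ?_⟩
  -- Injectivity on the open set `U` extends to the whole space: if `v` and `w` agree on `H`, then
  -- `u + t • (v - w)` lies in `U` for some `t ≠ 0` and agrees with `u` on `H`.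
  · obtain ⟨u, hu⟩ := h.nonempty
    have hcont : Filter.Tendsto (fun t : ℝ => u + t • (v - w)) (nhdsWithin 0 {0}ᶜ)
        (nhds u) := by
      have : Continuous fun t : ℝ => u + t • (v - w) := by fun_prop
      simpa using (this.tendsto 0).mono_left nhdsWithin_le_nhds
    obtain ⟨t, htU, ht⟩ := ((hcont.eventually (h.isOpen.mem_nhds hu)).and
      self_mem_nhdsWithin).exists
    have hu' := hi (x₁ := expMap (u + t • (v - w))) (x₂ := expMap u)
      (h.domain ▸ ⟨_, htU, rfl⟩) (h.domain ▸ ⟨_, hu, rfl⟩) (funext fun l => by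
        refine (coord _ htU _ hu l.1).2 ?_
        have hl := congrFun hvw l
        obtain ⟨l | l, hl'⟩ := l
        · simp only [Sum.elim_inl] at hl
          simp [hl]
        · simp only [Sum.elim_inr] at hl
          simp [Matrix.mulVec_add, Matrix.mulVec_smul, Matrix.mulVec_sub, hl])
    have h0 := expMap_injective hu'
    rw [add_eq_left, smul_eq_zero, sub_eq_zero] at h0
    exact h0.resolve_left ht
  · rw [h.domain] at hx hy
    obtain ⟨u, hu, rfl⟩ := hx
    obtain ⟨v, hv, rfl⟩ := hy
    exact congrArg expMap (hi (funext fun l => (coord u hu v hv l.1).1 (congrFun hxy l)))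

end IsLogAffine
-- Slices and the induction on the dimension
/-- The matrix obtained from `Q` by exchanging the roles of the `j`-th source coordinate and the
`i`-th target coordinate and then forgetting the new source coordinate. -/
noncomputable def pivot {n k : ℕ} (Q : Matrix (Fin k) (Fin (n + 1)) ℝ) (i : Fin k)
    (j : Fin (n + 1)) : Matrix (Fin k) (Fin n) ℝ :=
  Matrix.of fun r l =>
    -- Row `i` holds the coefficients of `u_j` solved from `(Q u)_i = const`; the other rows result
    -- from substituting this expression for `u_j`.
    if r = i then -(Q i (j.succAbove l) / Q i j)
    else Q r (j.succAbove l) + Q r j * -(Q i (j.succAbove l) / Q i j)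

lemma log_expMap {n : ℕ} (u : Fin n → ℝ) : (fun l => Real.log (expMap u l)) = u :=
  funext fun _ => Real.log_exp _

lemma mulVec_insertNth {n k : ℕ} (Q : Matrix (Fin k) (Fin (n + 1)) ℝ) (j : Fin (n + 1)) (s : ℝ)
    (v : Fin n → ℝ) (r : Fin k) :
    (Q *ᵥ (j.insertNth s v : Fin (n + 1) → ℝ)) r =
      Q r j * s + (fun l => Q r (j.succAbove l)) ⬝ᵥ v := by
  simp [Matrix.mulVec, dotProduct, Fin.sum_univ_succAbove _ j]

namespace IsLogAffine

/-- The slices of log-affine maps are log-affine, with exponents which depend only on the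
exponents of the given map. -/
lemma exists_slice {n k : ℕ} {U : Set (Fin (n + 1) → ℝ)} {Q : Matrix (Fin k) (Fin (n + 1)) ℝ}
    {c : Fin k → ℝ} {X : Set (Fin (n + 1) → ℝ)} {f : (Fin (n + 1) → ℝ) → (Fin k → ℝ)}
    (h : IsLogAffine U Q c X f) {i : Fin k} {j : Fin (n + 1)} (hq : Q i j ≠ 0) {b : ℝ}
    (hb : ∃ x ∈ X, f x i = b) :
    ∃ U' c' X' g, IsSliceGraph X f i j b X' g ∧ IsLogAffine U' (pivot Q i j) c' X' g := by
  obtain ⟨β, rfl⟩ : ∃ β, Real.exp β = b := by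
    obtain ⟨x, hx, rfl⟩ := hb
    rw [h.domain] at hx
    obtain ⟨u, hu, rfl⟩ := hx
    exact ⟨_, (congrFun (h.apply u hu) i).symm⟩
  set q : Fin n → ℝ := fun l => -(Q i (j.succAbove l) / Q i j) with hqdef
  set s₀ : ℝ := (β - c i) / Q i j with hs₀
  -- `lift v` is the only point over `v` on the hyperplane `(Q u)_i + c_i = β`: `hval` shows that it
  -- lies there, `hsurj` that there is no other.
  set lift : (Fin n → ℝ) → Fin (n + 1) → ℝ := fun v => j.insertNth (s₀ + q ⬝ᵥ v) v with hlift
  have hlj : ∀ v, lift v j = s₀ + q ⬝ᵥ v := fun v => by simp [hlift]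
  have hll : ∀ v l, lift v (j.succAbove l) = v l := fun v l => by simp [hlift]
  have hrow : (fun l => Q i (j.succAbove l)) = -(Q i j) • q := by
    ext l
    simp only [hqdef, Pi.smul_apply, smul_eq_mul]
    field_simp
  have hval : ∀ v, (Q *ᵥ lift v) i + c i = β := by
    intro v
    rw [mulVec_insertNth, hrow, smul_dotProduct, hs₀, smul_eq_mul]
    field_simp
    ring
  have hsurj : ∀ u, (Q *ᵥ u) i + c i = β → lift (j.removeNth u) = u := by
    intro u hu
    have hu' := hval (j.removeNth u)
    rw [← hu, ← Fin.insertNth_self_removeNth j u] at hu'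
    rw [mulVec_insertNth, mulVec_insertNth] at hu'
    simp only [Fin.removeNth_insertNth] at hu'
    have hs := mul_left_cancel₀ hq (add_right_cancel (add_right_cancel hu'))
    simp only [hlift, hs, Fin.insertNth_self_removeNth]
  have hlc : Continuous lift := by
    refine continuous_pi fun l => Fin.succAboveCases j ?_ (fun l => ?_) l
    · simp only [hlj]
      exact continuous_const.add (Continuous.dotProduct continuous_const continuous_id)
    · simp only [hll]
      exact continuous_apply l
  have hla : ∀ (v w : Fin n → ℝ) (a b : ℝ), a + b = 1 →
      lift (a • v + b • w) = a • lift v + b • lift w := by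
    intro v w a b hab
    ext l
    refine Fin.succAboveCases j ?_ (fun l => ?_) l
    · simp only [hlj, Pi.add_apply, Pi.smul_apply, dotProduct_add, dotProduct_smul, smul_eq_mul]
      linear_combination (-s₀) * hab
    · simp [hll]
  set g : (Fin n → ℝ) → Fin k → ℝ := fun x =>
    Function.update (f (expMap (lift fun l => Real.log (x l)))) i
      (expMap (lift fun l => Real.log (x l)) j) with hg
  have hgv : ∀ v, g (expMap v) =
      Function.update (f (expMap (lift v))) i (expMap (lift v) j) := by
    intro v
    simp only [hg, log_expMap]
  -- The level `b` enters the new affine map only through `s₀`, hence only through the constant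
  -- term.
  refine ⟨lift ⁻¹' U, fun r => if r = i then s₀ else c r + Q r j * s₀,
    expMap '' (lift ⁻¹' U), g, ?_, ?_, ?_, ?_, rfl, ?_⟩
  · intro x y hy
    rw [append_mem_mapGraph, append_mem_mapGraph]
    constructor
    · rintro ⟨hx, rfl⟩
      rw [h.domain] at hx
      obtain ⟨u, hu, rfl⟩ := hx
      rw [h.apply u hu] at hy
      have hlu := hsurj u (Real.exp_injective hy)
      have hr : j.removeNth (expMap u) = expMap (j.removeNth u) := rfl
      rw [hr, hgv, hlu]
      exact ⟨⟨_, by rwa [Set.mem_preimage, hlu], rfl⟩, rfl⟩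
    · rintro ⟨⟨v, hv, hvx⟩, hyx⟩
      rw [← hvx, hgv] at hyx
      have hxj : x j = expMap (lift v) j := by simpa using congrFun hyx i
      have hx : x = expMap (lift v) := by
        ext l
        refine Fin.succAboveCases j hxj (fun l => ?_) l
        have := congrFun hvx l
        simpa [expMap, hll, Fin.removeNth] using this.symm
      refine ⟨h.domain ▸ ⟨_, hv, hx.symm⟩, funext fun r => ?_⟩
      by_cases hr : r = i
      · subst hr
        rw [hy, hx, h.apply _ hv, expMap, Pi.add_apply, hval]
      · have := congrFun hyx r
        rw [hx]
        simpa [hr] using this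
  · exact h.isOpen.preimage hlc
  · intro v hv w hw a b ha hb hab
    rw [Set.mem_preimage, hla v w a b hab]
    exact h.convex hv hw ha hb hab
  · obtain ⟨x, hx, hxi⟩ := hb
    rw [h.domain] at hx
    obtain ⟨u, hu, rfl⟩ := hx
    rw [h.apply u hu] at hxi
    exact ⟨j.removeNth u, by rwa [Set.mem_preimage, hsurj u (Real.exp_injective hxi)]⟩
  · intro v hv
    rw [hgv, h.apply _ hv]
    ext r
    by_cases hr : r = i
    · subst hr
      have hp : (pivot Q r j *ᵥ v) r = q ⬝ᵥ v := by simp [Matrix.mulVec, pivot, hqdef]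
      simp [expMap, hlj, hp, add_comm]
    · have hp : (pivot Q i j *ᵥ v) r =
          (fun l => Q r (j.succAbove l)) ⬝ᵥ v + Q r j * (q ⬝ᵥ v) := by
        rw [← smul_eq_mul, ← smul_dotProduct, ← add_dotProduct]
        simp [Matrix.mulVec, pivot, hqdef, hr, dotProduct]
      simp only [expMap, hr, Function.update_of_ne, ne_eq, not_false_eq_true, Pi.add_apply,
        if_false, hp, hlift, mulVec_insertNth]
      ring_nf

/-- Log-affine maps between unit cubes with definable graph are monotone. -/
theorem isMonotoneMap {𝒮 : OMinimalStructure} {n k : ℕ} {U : Set (Fin n → ℝ)}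
    {Q : Matrix (Fin k) (Fin n) ℝ} {c : Fin k → ℝ} {X : Set (Fin n → ℝ)}
    {f : (Fin n → ℝ) → (Fin k → ℝ)} (h : IsLogAffine U Q c X f)
    (hd : 𝒮.Definable (mapGraph X f)) (hX : X ⊆ Set.Icc 0 1)
    (hf : Set.MapsTo f X (Set.Icc 0 1)) : IsMonotoneMap 𝒮 n X f := by
  have hXb : Bornology.IsBounded X := (Metric.isBounded_Icc 0 1).subset hX
  have hfb : Bornology.IsBounded (f '' X) := (Metric.isBounded_Icc 0 1).subset hf.image_subset
  induction n generalizing c with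
  | zero => exact h.isBoundedContinuousMap hd hXb hfb
  | succ n ih =>
    cases n with
    | zero => exact ⟨h.isBoundedContinuousMap hd hXb hfb, h.isMonotoneFun_apply hd hXb hfb⟩
    | succ n =>
      refine ⟨h.isBoundedContinuousMap hd hXb hfb, fun i j hij => ?_⟩
      have hq : Q i j ≠ 0 := fun hq => hij (h.independentOf hq)
      -- The common system of basis sets is read off from `pivot Q i j`, in which `b` does not
      -- occur.
      refine ⟨{H : Finset (Fin (n + 1) ⊕ Fin k) | H.card = n + 1 ∧ Function.Injective
        fun (v : Fin (n + 1) → ℝ) (l : ↥H) => Sum.elim v (pivot Q i j *ᵥ v) l.1},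
        fun b hb => ?_⟩
      obtain ⟨U', c', X', g, hs, hg⟩ := h.exists_slice hq hb
      -- Slicing moves `x_j` into the target. As source and target have the same bounds `0` and `1`
      -- in every coordinate, the bounds survive the exchange and the induction can proceed.
      have hmem : ∀ x' ∈ X', x' ∈ Set.Icc 0 1 ∧ g x' ∈ Set.Icc 0 1 := by
        intro x' hx'
        have hx := hs (j.insertNth (g x' i) x') (Function.update (g x') i b) (by simp)
        simp only [Fin.removeNth_insertNth, Function.update_idem, Fin.insertNth_apply_same,
          Function.update_eq_self, append_mem_mapGraph, hx', true_and, iff_true] at hx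
        have h1 := hX hx.1
        have h2 := hf hx.1
        rw [← hx.2] at h2
        refine ⟨⟨fun l => ?_, fun l => ?_⟩, fun r => ?_, fun r => ?_⟩
        · simpa using h1.1 (j.succAbove l)
        · simpa using h1.2 (j.succAbove l)
        · by_cases hr : r = i
          · subst hr; simpa using h1.1 j
          · simpa [hr] using h2.1 r
        · by_cases hr : r = i
          · subst hr; simpa using h1.2 j
          · simpa [hr] using h2.2 r
      have hX' : X' ⊆ Set.Icc 0 1 := fun x' hx' => (hmem x' hx').1
      have hg' : Set.MapsTo g X' (Set.Icc 0 1) := fun x' hx' => (hmem x' hx').2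
      exact ⟨X', g, hs, ih hg (hs.definable 𝒮 hd) hX' hg'
        ((Metric.isBounded_Icc 0 1).subset hX')
        ((Metric.isBounded_Icc 0 1).subset hg'.image_subset), hg.basisSets_eq⟩

end IsLogAffine

/-! ### Toric cubes as graphs of log-affine maps -/

/-- A finite family of vectors can be ordered so that a basis of its span comes first. -/
lemma exists_equiv_linearIndependent {n : ℕ} {V : Type*} [AddCommGroup V] [Module ℝ V]
    (A : Fin n → V) :
    ∃ (m k : ℕ) (e : Fin (m + k) ≃ Fin n),
      LinearIndependent ℝ (fun j : Fin m => A (e (Fin.castAdd k j))) ∧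
      ∀ i, A i ∈ Submodule.span ℝ (Set.range fun j : Fin m => A (e (Fin.castAdd k j))) := by
  classical
  obtain ⟨κ, p, hp, hspan, hli⟩ := exists_linearIndependent' ℝ A
  have : Finite κ := Finite.of_injective p hp
  have : Fintype κ := Fintype.ofFinite κ
  let eκ : Fin (Fintype.card κ) ≃ κ := (Fintype.equivFin κ).symm
  let ec : Fin (Fintype.card ↥(Set.range p)ᶜ) ≃ ↥(Set.range p)ᶜ := (Fintype.equivFin _).symm
  let e := finSumFinEquiv.symm.trans ((Equiv.sumCongr (eκ.trans (Equiv.ofInjective p hp)) ec).trans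
    (Equiv.Set.sumCompl (Set.range p)))
  have he : (fun j => A (e (Fin.castAdd _ j))) = (A ∘ p) ∘ eκ := by
    ext j
    simp [e]
  refine ⟨_, _, e, ?_, fun i => ?_⟩
  · rw [he]
    exact hli.comp _ eκ.injective
  · rw [he, eκ.surjective.range_comp, hspan]
    exact Submodule.subset_span ⟨i, rfl⟩

/-- Substituting `t = exp u` turns `0 < t < 1` into `u < 0` and monomials into exponentials of
linear forms. -/
lemma openToricCube_eq_expMap_image {d n : ℕ} (a : Fin n → Fin d → ℕ) :
    openToricCube a = (fun u : Fin d → ℝ => expMap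
      (Matrix.of (fun i l => (a i l : ℝ)) *ᵥ u)) '' {u | ∀ l, u l < 0} := by
  have key : ∀ u : Fin d → ℝ, (fun i => ∏ l, expMap u l ^ a i l) =
      expMap (Matrix.of (fun i l => (a i l : ℝ)) *ᵥ u) := by
    intro u
    ext i
    simp [expMap, Matrix.mulVec, dotProduct, Real.exp_sum, Real.exp_nat_mul]
  ext z
  constructor
  · rintro ⟨t, ht, rfl⟩
    have htu : expMap (fun l => Real.log (t l)) = t := funext fun l => Real.exp_log (ht l).1
    refine ⟨fun l => Real.log (t l), fun l => Real.log_neg (ht l).1 (ht l).2, ?_⟩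
    simp only [← key, htu]
  · rintro ⟨u, hu, rfl⟩
    exact ⟨expMap u, fun l => ⟨Real.exp_pos _, by simpa [expMap] using hu l⟩, key u⟩

theorem theorem6p2 (𝒮 : OMinimalStructure) {d n : ℕ} (a : Fin n → Fin d → ℕ) :
    IsGraphOfMonotoneMap 𝒮 (openToricCube a) := by
  set A : Matrix (Fin n) (Fin d) ℝ := Matrix.of fun i l => (a i l : ℝ) with hA
  obtain ⟨m, k, e, hli, hspan⟩ := exists_equiv_linearIndependent (fun i => A i)
  have hQ : ∀ i : Fin k, ∃ q : Fin m → ℝ,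
      ∑ j, q j • A (e (Fin.castAdd k j)) = A (e (Fin.natAdd m i)) := fun i =>
    (Submodule.mem_span_range_iff_exists_fun ℝ).1 (hspan _)
  choose q hq using hQ
  set Q : Matrix (Fin k) (Fin m) ℝ := Matrix.of q with hQdef
  set M : Matrix (Fin m) (Fin d) ℝ := Matrix.of fun j => A (e (Fin.castAdd k j)) with hM
  set T : Set (Fin d → ℝ) := {u | ∀ l, u l < 0} with hT
  have hfst : ∀ u, (A *ᵥ u) ∘ e ∘ Fin.castAdd k = M *ᵥ u := fun u => rfl
  have hsnd : ∀ u, (A *ᵥ u) ∘ e ∘ Fin.natAdd m = Q *ᵥ (M *ᵥ u) := by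
    intro u
    ext i
    have : (Q * M) i = A (e (Fin.natAdd m i)) := by
      rw [← hq i]
      ext l
      simp [Matrix.mul_apply, hQdef, hM]
    rw [Matrix.mulVec_mulVec]
    simp only [Function.comp_apply, Matrix.mulVec, this]
  -- Linearly independent rows give full row rank. Surjectivity makes the linear map open, so that
  -- the image of the orthant is open in `ℝᵐ`.
  have hsurj : Function.Surjective M.mulVecLin := by
    have hrank : M.rank = Fintype.card (Fin m) := LinearIndependent.rank_matrix hli
    refine LinearMap.range_eq_top.1 (Submodule.eq_top_of_finrank_eq ?_)
    rw [Module.finrank_fintype_fun_eq_card]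
    exact hrank
  set f : (Fin m → ℝ) → Fin k → ℝ := fun x => expMap (Q *ᵥ fun l => Real.log (x l)) with hf
  have hfe : ∀ v, f (expMap v) = expMap (Q *ᵥ v) := fun v => by simp only [hf, log_expMap]
  have hC : openToricCube a = {z | z ∘ e ∈ mapGraph (expMap '' (M.mulVecLin '' T)) f} := by
    rw [openToricCube_eq_expMap_image]
    ext z
    rw [Set.mem_ofPred_eq, mem_mapGraph]
    constructor
    · rintro ⟨u, hu, rfl⟩
      refine ⟨⟨_, ⟨u, hu, rfl⟩, ?_⟩, ?_⟩
      · rw [Matrix.mulVecLin_apply, ← hfst]; rfl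
      · have h1 : (expMap (A *ᵥ u) ∘ e) ∘ Fin.castAdd k = expMap (M *ᵥ u) := rfl
        have h2 : (expMap (A *ᵥ u) ∘ e) ∘ Fin.natAdd m = expMap (Q *ᵥ (M *ᵥ u)) := by
          rw [← hsnd]; rfl
        exact h2.trans (by rw [← hA, h1, hfe])
    · rintro ⟨⟨_, ⟨u, hu, rfl⟩, h1⟩, h2⟩
      rw [← h1, Matrix.mulVecLin_apply, hfe, ← hsnd] at h2
      refine ⟨u, hu, ?_⟩
      ext i
      obtain ⟨i, rfl⟩ := e.surjective i
      refine Fin.addCases (fun i => ?_) (fun i => ?_) i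
      · exact congrFun h1 i
      · exact (congrFun h2 i).symm
  have hIcc : openToricCube a ⊆ Set.Icc 0 1 := by
    rintro _ ⟨t, ht, rfl⟩
    exact ⟨fun i => Finset.prod_nonneg fun l _ => pow_nonneg (ht l).1.le _,
      fun i => Finset.prod_le_one (fun l _ => pow_nonneg (ht l).1.le _)
        fun l _ => pow_le_one₀ (ht l).1.le (ht l).2.le⟩
  have hmem : ∀ x ∈ expMap '' (M.mulVecLin '' T), Fin.append x (f x) ∘ e.symm ∈ openToricCube a := by
    intro x hx
    rw [hC, Set.mem_ofPred_eq, Function.comp_assoc, Equiv.symm_comp_self, Function.comp_id,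
      append_mem_mapGraph]
    exact ⟨hx, rfl⟩
  refine ⟨m, k, e, expMap '' (M.mulVecLin '' T), f, ?_, hC⟩
  have hlog : IsLogAffine (M.mulVecLin '' T) Q 0 (expMap '' (M.mulVecLin '' T)) f := by
    have hTo : IsOpen T := by
      simp only [hT, Set.ofPred_forall]
      exact isOpen_iInter_of_finite fun i => isOpen_lt (continuous_apply i) continuous_const
    have hTc : Convex ℝ T := by
      simp only [hT, Set.ofPred_forall]
      exact convex_iInter fun l => convex_halfSpace_lt
        (LinearMap.proj (R := ℝ) (φ := fun _ : Fin d => ℝ) l).isLinear 0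
    exact ⟨M.mulVecLin.isOpenMap_of_finiteDimensional hsurj _ hTo, hTc.linear_image _,
      Set.Nonempty.image _ ⟨fun _ => -1, fun _ => by norm_num⟩, rfl,
      fun v _ => by rw [hfe, add_zero]⟩
  refine hlog.isMonotoneMap ?_ ?_ ?_
  -- Up to the permutation `e` of coordinates the graph is the toric cube, so it is definable
  -- although `f` is written with `exp` and `log`.
  · have := 𝒮.definable_reindex e.symm (𝒮.definable_openToricCube a)
    convert this using 1
    ext w
    rw [hC, Set.mem_ofPred_eq, Set.mem_ofPred_eq, Function.comp_assoc, Equiv.symm_comp_self,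
      Function.comp_id]
  · intro x hx
    have := hIcc (hmem x hx)
    exact ⟨fun l => by simpa using this.1 (e (Fin.castAdd k l)),
      fun l => by simpa using this.2 (e (Fin.castAdd k l))⟩
  · intro x hx
    have := hIcc (hmem x hx)
    exact ⟨fun l => by simpa using this.1 (e (Fin.natAdd m l)),
      fun l => by simpa using this.2 (e (Fin.natAdd m l))⟩
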